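/- **Notation.** Let $f \in \mathbb{Z}[x]$ be an irreducible polynomial of degree $n$ with roots $\alpha_1,\dots,\alpha_n$ in its splitting field $K$ over $\mathbb{Q}$, and let $d = [K:\mathbb{Q}]$. Let $\Sigma_K : K \to \mathbb{C}^d$, $\alpha \mapsto (\sigma(\alpha))_\sigma$, be the Minkowski embedding, $\sigma$ running over the $d$ embeddings $K \hookrightarrow \mathbb{C}$. It takes values in the $d$-dimensional Euclidean space $K_{\mathbb{R}} = K\otimes_{\mathbb{Q}}\mathbb{R}$, realized as the real subspace of the vectors $(x_\sigma)_\sigma \in \mathbb{C}^d$ with $x_{\bar\sigma} = \overline{x_\sigma}$ for all $\sigma$, with inner product $\langle x, y\rangle = \sum_\sigma x_\sigma \overline{y_\sigma}$. Put $$L_f = \Sigma_K\big(\operatorname{span}_{\mathbb{Z}}\{\alpha_1,\dots,\alpha_n\}\big) \subset K_{\mathbb{R}} .$$ For a lattice (discrete subgroup) $L \neq 0$ in a Euclidean space, let $|L|$ be the least norm of a nonzero vector of $L$ and $S(L) = \{x \in L : \|x\| = |L|\}$ the set of its minimal vectors. $L$ is *well-rounded* if $\operatorname{span}_{\mathbb{R}}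 L = \operatorname{span}_{\mathbb{R}} S(L)$, and *generic well-rounded* if moreover $|S(L)| = 2\operatorname{rank} L$. $L$ is *nearly orthogonal* if it has a $\mathbb{Z}$-basis such that, for every ordering $b_1,\dots,b_m$ of this basis and every $1 \le i \le m-1$, the angle (in $[0,\pi/2]$) between $b_{i+1}$ and the subspace $\operatorname{span}_{\mathbb{R}}\{b_1,\dots,b_i\}$ is at least $\pi/3$. **Theorem.** Let $n \geq 3$ be prime. There are infinitely many irreducible polynomials $f \in \mathbb{Z}[x]$ of degree $n$ such that $L_f$ is a lattice of rank $n$ in $K_{\mathbb{R}}$ which is generic well-rounded and nearly orthogonal and has a $\mathbb{Z}$-basis consisting of minimal vectors. Explicitly, if $a_0, a_{n-1}$ are integers with $$|a_0| > \frac{8(n-1)\,n!}{\sqrt{(n-2)^2+16(n-1)}-(n-2)} \quad\text{and}\quad |a_{n-1}| > |a_0|+1,$$ then $f = x^n + a_{n-1}x^{n-1} + a_0$ is irreducible and $L_f$ has all of these properties. -/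

import Mathlib

open Polynomial

noncomputable section

namespace ConjugateLattice

/-! ### Lattices in a real inner product space -/

section Lattices

variable {E : Type*} [NormedAddCommGroup E] [InnerProductSpace ℝ E]

/-- `L` is a (Euclidean) lattice of rank `m` in `E`: a discrete subgroup of `ℤ`-rank `m`
(not necessarily of full rank in `E`). -/
def IsLatticeOfRank (L : Submodule ℤ E) (m : ℕ) : Prop :=
  DiscreteTopology L ∧ Module.finrank ℤ L = m

/-- The minimal norm of `L`, i.e. the least norm of a nonzero vector of `L`
(the infimum is attained when `L` is a nonzero discrete subgroup). -/
def minNorm (L : Submodule ℤ E) : ℝ :=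
  sInf {r : ℝ | ∃ x ∈ L, x ≠ 0 ∧ ‖x‖ = r}

/-- The set `S(L)` of minimal vectors of `L`. -/
def minVectors (L : Submodule ℤ E) : Set E :=
  {x : E | x ∈ L ∧ ‖x‖ = minNorm L}

/-- `L` is well-rounded: `L` and `S(L)` span the same real subspace. -/
def IsWellRounded (L : Submodule ℤ E) : Prop :=
  Submodule.span ℝ (L : Set E) = Submodule.span ℝ (minVectors L)

/-- `L` is generic well-rounded: it is well-rounded and has exactly `2 · rank L` minimal
vectors. -/
def IsGenericWellRounded (L : Submodule ℤ E) : Prop :=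
  IsWellRounded L ∧ (minVectors L).encard = ((2 * Module.finrank ℤ L : ℕ) : ℕ∞)

/-- The angle in `[0, π/2]` between a vector `v` and a subspace `W`: the angle between `v` and its
orthogonal projection to `W` (it is `π/2` when this projection vanishes). -/
def angleWithSubspace [FiniteDimensional ℝ E] (v : E) (W : Submodule ℝ E) : ℝ :=
  InnerProductGeometry.angle v (W.starProjection v)

/-- The ordered system `b₁, …, bₘ` is weakly nearly orthogonal: each vector after the first makes
an angle at least `π/3` with the real span of the vectors before it. -/
def IsWeaklyNearlyOrthogonal [FiniteDimensional ℝ E] {m : ℕ} (b : Fin m → E) : Prop :=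
  ∀ i : Fin m, 0 < (i : ℕ) →
    Real.pi / 3 ≤ angleWithSubspace (b i) (Submodule.span ℝ (b '' {j : Fin m | j < i}))

/-- `L` is nearly orthogonal: it has a basis every ordering of which is weakly nearly
orthogonal. -/
def IsNearlyOrthogonal [FiniteDimensional ℝ E] (L : Submodule ℤ E) : Prop :=
  ∃ (m : ℕ) (b : Module.Basis (Fin m) ℤ L), ∀ s : Equiv.Perm (Fin m),
    IsWeaklyNearlyOrthogonal (fun i => (b (s i) : E))

/-- `L` has a `ℤ`-basis consisting of minimal vectors. -/
def HasMinimalBasis (L : Submodule ℤ E) : Prop :=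
  ∃ (m : ℕ) (b : Module.Basis (Fin m) ℤ L), ∀ i, (b i : E) ∈ minVectors L

end Lattices

/-! ### The Minkowski embedding and the lattice of a polynomial -/

section Minkowski

variable (K : Type*) [Field K] [NumberField K]

/-- The Euclidean space `K_ℝ = K ⊗_ℚ ℝ` of a number field `K` of degree `d`, realized as the real
subspace of `ℂ^d` (coordinates indexed by the embeddings `φ : K → ℂ`) of the vectors whose
coordinates at conjugate embeddings are conjugate. The inner product is inherited from `ℂ^d`; it is
`(x, y) ↦ ∑ φ, x φ * conj (y φ)`, which is real on this subspace. -/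
def minkowskiSubspace : Submodule ℝ (EuclideanSpace ℂ (K →+* ℂ)) where
  carrier := {x | ∀ φ : K →+* ℂ,
    x (NumberField.ComplexEmbedding.conjugate φ) = (starRingEnd ℂ) (x φ)}
  add_mem' := by
    intro x y hx hy φ
    simp [hx φ, hy φ]
  zero_mem' := by
    intro φ
    simp
  smul_mem' := by
    intro c x hx φ
    simp [hx φ]

/-- `K_ℝ` as a type, with the Euclidean structure of the subspace `minkowskiSubspace K`. -/
def MinkowskiSpace : Type _ := minkowskiSubspace K

instance MinkowskiSpace.instNormedAddCommGroup : NormedAddCommGroup (MinkowskiSpace K) :=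
  Submodule.normedAddCommGroup (minkowskiSubspace K)

instance MinkowskiSpace.instInnerProductSpace : InnerProductSpace ℝ (MinkowskiSpace K) :=
  Submodule.innerProductSpace (minkowskiSubspace K)

instance MinkowskiSpace.instFiniteDimensional : FiniteDimensional ℝ (MinkowskiSpace K) :=
  inferInstanceAs (FiniteDimensional ℝ (minkowskiSubspace K))

/-- The Minkowski embedding `Σ_K : K → K_ℝ`, `α ↦ (φ α)_φ`. -/
def minkowskiEmbedding : K →+ MinkowskiSpace K where
  toFun α := (⟨WithLp.toLp 2 (fun φ : K →+* ℂ => φ α), by intro φ; simp⟩ : minkowskiSubspace K)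
  map_zero' := by
    apply Subtype.ext
    ext φ
    exact map_zero φ
  map_add' := by
    intro α β
    apply Subtype.ext
    ext φ
    exact map_add φ α β

/-- The inner product on the image of `K` is `⟨Σ_K α, Σ_K β⟩ = ∑ φ, φ α * conj (φ β)`. -/
theorem inner_minkowskiEmbedding (α β : K) :
    ((inner ℝ (minkowskiEmbedding K α) (minkowskiEmbedding K β) : ℝ) : ℂ) =
      ∑ φ : K →+* ℂ, φ α * (starRingEnd ℂ) (φ β) := by
  have h1 : (inner ℝ (minkowskiEmbedding K α) (minkowskiEmbedding K β) : ℝ) =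
      ∑ φ : K →+* ℂ, (φ α * (starRingEnd ℂ) (φ β)).re := by
    change (∑ φ : K →+* ℂ, inner ℝ (φ α) (φ β) : ℝ) = _
    refine Finset.sum_congr rfl fun φ _ => ?_
    rw [Complex.inner]
    simp [Complex.mul_re, mul_comm]
  have h2 : (starRingEnd ℂ) (∑ φ : K →+* ℂ, φ α * (starRingEnd ℂ) (φ β)) =
      ∑ φ : K →+* ℂ, φ α * (starRingEnd ℂ) (φ β) := by
    rw [map_sum]
    exact Fintype.sum_equiv
      (NumberField.ComplexEmbedding.involutive_conjugate K).toPerm _ _ (fun φ => by simp)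
  rw [h1, ← Complex.re_sum]
  exact Complex.conj_eq_iff_re.mp h2

end Minkowski

/-- The splitting field over `ℚ` of a polynomial with integer coefficients. -/
def SplitField (f : ℤ[X]) : Type := (f.map (Int.castRingHom ℚ)).SplittingField

instance SplitField.instField (f : ℤ[X]) : Field (SplitField f) :=
  inferInstanceAs (Field (f.map (Int.castRingHom ℚ)).SplittingField)

instance SplitField.instCharZero (f : ℤ[X]) : CharZero (SplitField f) :=
  inferInstanceAs (CharZero (f.map (Int.castRingHom ℚ)).SplittingField)

/-- Being a splitting field does not depend on the choice of the `ℚ`-algebra structure (which is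
unique). -/
theorem isSplittingField_congr {F : Type*} [Field F] (A B : Algebra ℚ F) (g : ℚ[X])
    (h : @IsSplittingField ℚ F _ _ A g) : @IsSplittingField ℚ F _ _ B g := by
  have e : A = B := Subsingleton.elim A B
  subst e
  exact h

/-- `SplitField f` is a splitting field of `f` for its canonical `ℚ`-algebra structure. -/
instance SplitField.instIsSplittingField (f : ℤ[X]) :
    IsSplittingField ℚ (SplitField f) (f.map (Int.castRingHom ℚ)) :=
  isSplittingField_congr (F := (f.map (Int.castRingHom ℚ)).SplittingField) inferInstance
    DivisionRing.toRatAlgebra _ (IsSplittingField.splittingField (f.map (Int.castRingHom ℚ)))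

instance SplitField.instNumberField (f : ℤ[X]) : NumberField (SplitField f) where
  to_charZero := inferInstance
  to_finiteDimensional := IsSplittingField.finiteDimensional _ (f.map (Int.castRingHom ℚ))

/-- The `ℤ`-module `M_f` generated by the roots of `f` in its splitting field. -/
def rootModule (f : ℤ[X]) : Submodule ℤ (SplitField f) :=
  Submodule.span ℤ (f.rootSet (SplitField f))

/-- `L_f = Σ_K(M_f)`, where `K` is the splitting field of `f`. -/
def conjLattice (f : ℤ[X]) : Submodule ℤ (MinkowskiSpace (SplitField f)) :=
  (rootModule f).map (minkowskiEmbedding (SplitField f)).toIntLinearMap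

end ConjugateLattice

end

/-! Write `m = n - 1`, `b = a_{n-1}`, `c = a₀`. Since `|b| > |c| + 1`, a Perron-type argument shows
that `f` has exactly one complex root `z` outside the open unit disc, and `|z| ≥ |b| - 1`.
Irreducibility follows: each proper monic factor over `ℤ` has a nonzero integer constant term, so
each would need its own root outside the disc.

Every embedding of the splitting field permutes the `n` complex roots, so it sends exactly one `αᵢ`
to `z` and the others into the disc. By transitivity of the Galois group, each `αᵢ` goes to `z`
under the same number `N = d/n` of embeddings. Hence the Gram matrix of the vectors `Σ_K(αᵢ)` has a
constant diagonal `D ≥ N|z|²` and off-diagonal entries at most `N(2|z| + n)`. Once `|z| ≥ 9(n - 1)`,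
it dominates `(3/4)D` times the identity (`isQuasiOrthogonal_minkowskiEmbedding`).

That one inequality (`IsQuasiOrthogonal`) yields every lattice property. The vectors are
independent. An integer combination with `∑ cᵢ² ≥ 2` has squared norm at least `3D/2 > D`, so the
minimal vectors are exactly the `± vᵢ`. Finally, each `v k` lies at squared distance at least `3D/4`
from the span of any of the others, so its angle with that span is at least `π/3`. -/

namespace ConjugateLattice

/-! ### Lattices generated by almost orthogonal vectors of equal length -/

section QuasiOrthogonal

variable {E : Type*} [NormedAddCommGroup E] [InnerProductSpace ℝ E] {n : ℕ}

/-- A finite system of vectors of common squared norm `D > 0` whose Gram form is bounded below by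
`3/4` of the form it would have if the system were orthogonal. -/
structure IsQuasiOrthogonal (v : Fin n → E) (D : ℝ) : Prop where
  pos : 0 < D
  norm_sq : ∀ i, ‖v i‖ ^ 2 = D
  le_norm_sq : ∀ c : Fin n → ℝ, 3 / 4 * D * ∑ i, c i ^ 2 ≤ ‖∑ i, c i • v i‖ ^ 2

/-- Diagonal dominance: `2|cᵢcⱼ| ≤ cᵢ² + cⱼ²` bounds the Gram form below by `D(1 - (n - 1)ε) ∑ cᵢ²`.
-/
theorem isQuasiOrthogonal_of_abs_inner_le {v : Fin n → E} {D ε : ℝ} (hD : 0 < D)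
    (hv : ∀ i, ‖v i‖ ^ 2 = D) (hε : 4 * ((n : ℝ) - 1) * ε ≤ 1)
    (h : ∀ i j, i ≠ j → |inner ℝ (v i) (v j)| ≤ ε * D) : IsQuasiOrthogonal v D := by
  refine ⟨hD, hv, fun c => ?_⟩
  -- The `if` term corrects the diagonal, where the entry is exactly `D`; the bound is thus uniform
  -- in `i, j` and can be summed over all pairs.
  have key : ∀ i j, -(ε * D / 2) * (c i ^ 2 + c j ^ 2) +
      (if i = j then (D + ε * D) * c i ^ 2 else 0) ≤ c i * (c j * inner ℝ (v i) (v j)) := by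
    intro i j
    by_cases hij : i = j
    · subst hij
      rw [real_inner_self_eq_norm_sq, hv]
      simp only [if_true]
      apply le_of_eq
      ring
    · have h1 := h i j hij
      have h3 : |c i * c j * inner ℝ (v i) (v j)| ≤ |c i * c j| * (ε * D) := by
        rw [abs_mul]
        exact mul_le_mul_of_nonneg_left h1 (abs_nonneg _)
      have h4 : |c i * c j| ≤ (c i ^ 2 + c j ^ 2) / 2 := by
        rw [abs_le]
        constructor <;> nlinarith [sq_nonneg (c i + c j), sq_nonneg (c i - c j)]
      have h5 := mul_le_mul_of_nonneg_right h4 ((abs_nonneg _).trans h1)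
      have h6 := neg_abs_le (c i * c j * inner ℝ (v i) (v j))
      simp only [hij, if_false]
      nlinarith
  have hsum : ‖∑ i, c i • v i‖ ^ 2 = ∑ i, ∑ j, c i * (c j * inner ℝ (v i) (v j)) := by
    rw [← real_inner_self_eq_norm_sq, sum_inner]
    refine Finset.sum_congr rfl fun i _ => ?_
    rw [inner_sum]
    refine Finset.sum_congr rfl fun j _ => ?_
    rw [real_inner_smul_left, real_inner_smul_right]
  rw [hsum]
  refine le_trans ?_ (Finset.sum_le_sum fun i _ => Finset.sum_le_sum fun j _ => key i j)
  have hval : ∑ i, ∑ j, (-(ε * D / 2) * (c i ^ 2 + c j ^ 2) +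
      (if i = j then (D + ε * D) * c i ^ 2 else 0)) =
      D * (1 - ((n : ℝ) - 1) * ε) * ∑ i, c i ^ 2 := by
    simp only [Finset.sum_add_distrib, ← Finset.mul_sum, Finset.sum_const, Finset.card_univ,
      Fintype.card_fin, Finset.sum_ite_eq, Finset.mem_univ, if_true, nsmul_eq_mul]
    ring
  rw [hval]
  refine mul_le_mul_of_nonneg_right ?_ (Finset.sum_nonneg fun i _ => sq_nonneg _)
  nlinarith

theorem one_le_sum_sq {c : Fin n → ℤ} (hc : c ≠ 0) : 1 ≤ ∑ i, c i ^ 2 := by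
  obtain ⟨i, hi⟩ := Function.ne_iff.mp hc
  have h0 : c i ≠ 0 := hi
  have h1 : 0 < c i ^ 2 := by positivity
  exact (Int.add_one_le_iff.mpr h1).trans (Finset.single_le_sum (f := fun i => c i ^ 2) (fun j _ => sq_nonneg _)
    (Finset.mem_univ i))

theorem eq_single_of_sum_sq_le_one {c : Fin n → ℤ} (hc : c ≠ 0) (h : ∑ i, c i ^ 2 ≤ 1) :
    ∃ i, c = Pi.single i 1 ∨ c = Pi.single i (-1) := by
  obtain ⟨i, hi⟩ := Function.ne_iff.mp hc
  have h0 : 0 < c i ^ 2 := by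
    have : c i ≠ 0 := hi
    positivity
  have hs := Finset.add_sum_erase Finset.univ (fun j => c j ^ 2) (Finset.mem_univ i)
  have hnn : 0 ≤ ∑ j ∈ Finset.univ.erase i, c j ^ 2 := Finset.sum_nonneg fun j _ => sq_nonneg _
  have hz : ∑ j ∈ Finset.univ.erase i, c j ^ 2 = 0 := by omega
  rw [Finset.sum_eq_zero_iff_of_nonneg fun j _ => sq_nonneg _] at hz
  have hother : ∀ j, j ≠ i → c j = 0 := fun j hj => by
    simpa using hz j (Finset.mem_erase.mpr ⟨hj, Finset.mem_univ j⟩)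
  have hci : c i ^ 2 = 1 := by omega
  have hfun : c = Pi.single i (c i) := by
    ext j
    by_cases hj : j = i
    · subst hj; simp
    · simp [hj, hother j hj]
  refine ⟨i, ?_⟩
  rcases sq_eq_one_iff.mp hci with h | h
  · left; rw [hfun, h]
  · right; rw [hfun, h]

namespace IsQuasiOrthogonal

variable {v : Fin n → E} {D : ℝ}

theorem linearIndependent (h : IsQuasiOrthogonal v D) : LinearIndependent ℝ v := by
  rw [Fintype.linearIndependent_iff]
  intro c hc i
  have h1 := h.le_norm_sq c
  rw [hc, norm_zero] at h1
  have hD := h.pos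
  have h2 : c i ^ 2 ≤ ∑ i, c i ^ 2 :=
    Finset.single_le_sum (f := fun i => c i ^ 2) (fun j _ => sq_nonneg _) (Finset.mem_univ i)
  have h3 : c i ^ 2 ≤ 0 := by
    by_contra hcon
    push Not at hcon
    have : 0 < 3 / 4 * D * ∑ i, c i ^ 2 := by
      have := hcon.trans_le h2
      positivity
    norm_num at h1
    linarith
  exact pow_eq_zero_iff (two_ne_zero) |>.mp (le_antisymm h3 (sq_nonneg _))

theorem linearIndependent_int (h : IsQuasiOrthogonal v D) : LinearIndependent ℤ v :=
  h.linearIndependent.restrict_scalars' ℤ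

/-- The system as a `ℤ`-basis of the lattice it generates. -/
noncomputable def basis (h : IsQuasiOrthogonal v D) :
    Module.Basis (Fin n) ℤ (Submodule.span ℤ (Set.range v)) :=
  Module.Basis.span h.linearIndependent_int

theorem coe_basis (h : IsQuasiOrthogonal v D) (i : Fin n) : (h.basis i : E) = v i := by
  rw [basis, Module.Basis.span_apply]

theorem finrank_span (h : IsQuasiOrthogonal v D) :
    Module.finrank ℤ (Submodule.span ℤ (Set.range v)) = n := by
  rw [finrank_span_eq_card h.linearIndependent_int, Fintype.card_fin]

theorem mul_sum_sq_le_norm_sq (h : IsQuasiOrthogonal v D) (c : Fin n → ℤ) :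
    3 / 4 * D * ((∑ i, c i ^ 2 : ℤ) : ℝ) ≤ ‖∑ i, c i • v i‖ ^ 2 := by
  have := h.le_norm_sq fun i => (c i : ℝ)
  simpa [Int.cast_smul_eq_zsmul] using this

theorem norm_eq (h : IsQuasiOrthogonal v D) (i : Fin n) : ‖v i‖ = √D := by
  rw [← h.norm_sq i, Real.sqrt_sq (norm_nonneg _)]

theorem isLatticeOfRank (h : IsQuasiOrthogonal v D) :
    IsLatticeOfRank (Submodule.span ℤ (Set.range v)) n := by
  refine ⟨?_, h.finrank_span⟩
  have hD := h.pos
  refine DiscreteTopology.of_forall_le_norm (r := √(3 / 4 * D)) (by positivity) fun x hx => ?_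
  obtain ⟨c, hc⟩ := (Submodule.mem_span_range_iff_exists_fun ℤ).mp x.2
  have hc0 : c ≠ 0 := by
    rintro rfl
    apply hx
    ext
    simp [← hc]
  have h1 := h.mul_sum_sq_le_norm_sq c
  have h2 : (1 : ℝ) ≤ ((∑ i, c i ^ 2 : ℤ) : ℝ) := by exact_mod_cast one_le_sum_sq hc0
  rw [hc] at h1
  refine Real.sqrt_le_iff.mpr ⟨norm_nonneg _, ?_⟩
  change _ ≤ ‖(x : E)‖ ^ 2
  nlinarith

/-- A nonzero lattice vector is either one of the `± v i` or has squared norm more than `D`. -/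
theorem eq_or_lt_norm_sq (h : IsQuasiOrthogonal v D) {x : E}
    (hx : x ∈ Submodule.span ℤ (Set.range v)) (hx0 : x ≠ 0) :
    (∃ i, x = v i ∨ x = -v i) ∨ √D < ‖x‖ := by
  obtain ⟨c, hc⟩ := (Submodule.mem_span_range_iff_exists_fun ℤ).mp hx
  have hc0 : c ≠ 0 := by
    rintro rfl
    apply hx0
    simp [← hc]
  by_cases hle : ∑ i, c i ^ 2 ≤ 1
  · left
    obtain ⟨i, hi⟩ := eq_single_of_sum_sq_le_one hc0 hle
    refine ⟨i, hi.imp (fun hi => ?_) (fun hi => ?_)⟩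
    · simp [← hc, hi, Pi.single_apply]
    · simp [← hc, hi, Pi.single_apply]
  · right
    have hD := h.pos
    have h1 := h.mul_sum_sq_le_norm_sq c
    have h2 : (2 : ℝ) ≤ ((∑ i, c i ^ 2 : ℤ) : ℝ) := by
      have : (2 : ℤ) ≤ ∑ i, c i ^ 2 := by omega
      exact_mod_cast this
    rw [hc] at h1
    exact (Real.sqrt_lt' (norm_pos_iff.mpr hx0)).mpr (by nlinarith)

theorem mem_span (_ : IsQuasiOrthogonal v D) (i : Fin n) : v i ∈ Submodule.span ℤ (Set.range v) :=
  Submodule.subset_span ⟨i, rfl⟩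

theorem ne_zero (h : IsQuasiOrthogonal v D) (i : Fin n) : v i ≠ 0 :=
  h.linearIndependent.ne_zero i

theorem minNorm_eq (h : IsQuasiOrthogonal v D) (hn : 0 < n) :
    minNorm (Submodule.span ℤ (Set.range v)) = √D := by
  refine IsLeast.csInf_eq ⟨⟨v ⟨0, hn⟩, h.mem_span _, h.ne_zero _, h.norm_eq _⟩, ?_⟩
  rintro r ⟨x, hx, hx0, rfl⟩
  rcases h.eq_or_lt_norm_sq hx hx0 with ⟨i, rfl | rfl⟩ | hlt
  · exact (h.norm_eq i).ge
  · rw [norm_neg]; exact (h.norm_eq i).ge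
  · exact hlt.le

theorem minVectors_eq (h : IsQuasiOrthogonal v D) (hn : 0 < n) :
    minVectors (Submodule.span ℤ (Set.range v)) = Set.range v ∪ Set.range fun i => -v i := by
  ext x
  simp only [minVectors, h.minNorm_eq hn, Set.mem_ofPred_eq, Set.mem_union, Set.mem_range]
  constructor
  · rintro ⟨hx, hnorm⟩
    have hx0 : x ≠ 0 := by
      rintro rfl
      rw [norm_zero] at hnorm
      exact (Real.sqrt_pos.mpr h.pos).ne hnorm
    rcases h.eq_or_lt_norm_sq hx hx0 with ⟨i, rfl | rfl⟩ | hlt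
    · exact Or.inl ⟨i, rfl⟩
    · exact Or.inr ⟨i, rfl⟩
    · exact absurd hnorm hlt.ne'
  · rintro (⟨i, rfl⟩ | ⟨i, rfl⟩)
    · exact ⟨h.mem_span i, h.norm_eq i⟩
    · exact ⟨neg_mem (h.mem_span i), by rw [norm_neg, h.norm_eq]⟩

theorem encard_minVectors (h : IsQuasiOrthogonal v D) (hn : 0 < n) :
    (minVectors (Submodule.span ℤ (Set.range v))).encard = ((2 * n : ℕ) : ℕ∞) := by
  have hinj := h.linearIndependent.injective
  have hcard : ∀ w : Fin n → E, Function.Injective w → (Set.range w).encard = (n : ℕ∞) := by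
    intro w hw
    rw [← Set.image_univ, hw.encard_image, Set.encard_univ]
    simp
  rw [h.minVectors_eq hn, Set.encard_union_eq, hcard v hinj,
    hcard (fun i => -v i) (neg_injective.comp hinj)]
  · push_cast
    ring
  · rw [Set.disjoint_left]
    rintro _ ⟨i, rfl⟩ ⟨j, hj⟩
    simp only at hj
    have hij : v i + v j = 0 := by rw [← hj]; simp
    -- A coincidence `v i = -v j` would be a linear relation whose `i`-th coefficient is 2 if `i =
    -- j` and 1 otherwise.
    have h1 := Fintype.linearIndependent_iff.mp h.linearIndependent
      (Pi.single i 1 + Pi.single j 1) (by simpa [add_smul, Finset.sum_add_distrib,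
        Pi.single_apply] using hij) i
    by_cases hij' : i = j
    · subst hij'
      simp at h1
    · simp [hij'] at h1

theorem isGenericWellRounded (h : IsQuasiOrthogonal v D) (hn : 0 < n) :
    IsGenericWellRounded (Submodule.span ℤ (Set.range v)) := by
  refine ⟨?_, by rw [h.encard_minVectors hn, h.finrank_span]⟩
  refine le_antisymm (Submodule.span_le.mpr ?_) (Submodule.span_mono fun x hx => hx.1)
  intro x hx
  obtain ⟨c, rfl⟩ := (Submodule.mem_span_range_iff_exists_fun ℤ).mp hx
  refine Submodule.sum_mem _ fun i _ => ?_
  rw [← Int.cast_smul_eq_zsmul ℝ]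
  refine Submodule.smul_mem _ _ (Submodule.subset_span ?_)
  rw [h.minVectors_eq hn]
  exact Or.inl ⟨i, rfl⟩

theorem hasMinimalBasis (h : IsQuasiOrthogonal v D) (hn : 0 < n) :
    HasMinimalBasis (Submodule.span ℤ (Set.range v)) := by
  refine ⟨n, h.basis, fun i => ?_⟩
  rw [h.coe_basis, h.minVectors_eq hn]
  exact Or.inl ⟨i, rfl⟩

/-- The projection of `v k` to the span of some of the other vectors is at most half as long as
`v k`. -/
theorem norm_sq_starProjection_le [FiniteDimensional ℝ E] (h : IsQuasiOrthogonal v D) (k : Fin n)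
    {s : Set (Fin n)} (hk : k ∉ s) :
    ‖(Submodule.span ℝ (v '' s)).starProjection (v k)‖ ^ 2 ≤ D / 4 := by
  set W := Submodule.span ℝ (v '' s) with hW
  set p := W.starProjection (v k) with hp
  have hpW : p ∈ W := Submodule.starProjection_apply_mem _ _
  have hinner : inner ℝ (v k) p = ‖p‖ ^ 2 := by
    have := Submodule.starProjection_inner_eq_zero (K := W) (v k) p hpW
    rw [inner_sub_left, real_inner_self_eq_norm_sq] at this
    linarith
  obtain ⟨l, hl, hlp⟩ := (Finsupp.mem_span_image_iff_linearCombination ℝ).mp hpW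
  have hlk : l k = 0 := by
    by_contra hne
    exact hk ((Finsupp.mem_supported ℝ l).mp hl (Finsupp.mem_support_iff.mpr hne))
  have hsum : ∑ i, l i • v i = p := by
    rw [← hlp, Finsupp.linearCombination_apply, Finsupp.sum_fintype _ _ (by simp)]
  have hD := h.pos
  -- The Gram bound is applied to `p - v k`. Its `k`-th coefficient is `-1` because `k ∉ s`, so `D -
  -- ‖p‖² = ‖p - v k‖² ≥ 3D/4`.
  have h1 := h.le_norm_sq fun i => l i - Pi.single (M := fun _ => ℝ) k 1 i
  have h2 : ∑ i, (l i - Pi.single (M := fun _ => ℝ) k 1 i) • v i = p - v k := by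
    simp [sub_smul, Finset.sum_sub_distrib, hsum, Pi.single_apply]
  have h3 : (1 : ℝ) ≤ ∑ i, (l i - Pi.single (M := fun _ => ℝ) k 1 i) ^ 2 := by
    refine le_trans ?_ (Finset.single_le_sum
      (f := fun i => (l i - Pi.single (M := fun _ => ℝ) k 1 i) ^ 2)
      (fun j _ => sq_nonneg _) (Finset.mem_univ k))
    simp [hlk]
  rw [h2, norm_sub_sq_real, real_inner_comm, hinner, h.norm_sq] at h1
  nlinarith

theorem pi_div_three_le_angleWithSubspace [FiniteDimensional ℝ E] (h : IsQuasiOrthogonal v D)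
    (k : Fin n) {s : Set (Fin n)} (hk : k ∉ s) :
    Real.pi / 3 ≤ angleWithSubspace (v k) (Submodule.span ℝ (v '' s)) := by
  have hle := h.norm_sq_starProjection_le k hk
  rw [angleWithSubspace, InnerProductGeometry.angle]
  set W := Submodule.span ℝ (v '' s) with hW
  set p := W.starProjection (v k) with hp
  have hpW : p ∈ W := Submodule.starProjection_apply_mem _ _
  have hinner : inner ℝ (v k) p = ‖p‖ ^ 2 := by
    have := Submodule.starProjection_inner_eq_zero (K := W) (v k) p hpW
    rw [inner_sub_left, real_inner_self_eq_norm_sq] at this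
    linarith
  have hD := h.pos
  rw [← Real.arccos_cos (x := Real.pi / 3) (by positivity) (by linarith [Real.pi_pos]),
    Real.cos_pi_div_three]
  apply Real.arccos_le_arccos
  rw [hinner]
  have hp2 : ‖p‖ ≤ ‖v k‖ / 2 := by
    refine abs_le_of_sq_le_sq' ?_ (by positivity) |>.2
    rw [div_pow, h.norm_sq]
    linarith
  -- For a zero projection the cosine is `0 / 0 = 0`, consistent with the angle `π/2`.
  rcases (norm_nonneg p).eq_or_lt with h0 | h0
  · rw [← h0]
    norm_num
  · have hv : 0 < ‖v k‖ := norm_pos_iff.mpr (h.ne_zero k)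
    rw [div_le_iff₀ (by positivity)]
    nlinarith

theorem isNearlyOrthogonal [FiniteDimensional ℝ E] (h : IsQuasiOrthogonal v D) :
    IsNearlyOrthogonal (Submodule.span ℤ (Set.range v)) := by
  refine ⟨n, h.basis, fun s i _ => ?_⟩
  have himage : (fun i => (h.basis (s i) : E)) '' {j | j < i} = v '' (s '' {j | j < i}) := by
    rw [Set.image_image]
    simp only [h.coe_basis]
  simp only [himage]
  rw [h.coe_basis]
  refine h.pi_div_three_le_angleWithSubspace _ ?_
  rintro ⟨j, hj, hji⟩
  exact (ne_of_lt hj) (s.injective hji)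

end IsQuasiOrthogonal

end QuasiOrthogonal

/-! ### Location of the roots and irreducibility of the trinomial -/

section Trinomial

/-- The trinomial `x ^ (m + 1) + b x ^ m + c`. -/
noncomputable def trinomial {R : Type*} [CommRing R] (m : ℕ) (b c : R) : R[X] :=
  X ^ (m + 1) + C b * X ^ m + C c

/-- The quotient of `trinomial m b c` by `X - C α` when `α` is a root. -/
noncomputable def trinomialQuotient {R : Type*} [CommRing R] (m : ℕ) (b α : R) : R[X] :=
  X ^ m + C (α + b) * ∑ i ∈ Finset.range m, X ^ i * C α ^ (m - 1 - i)

theorem trinomial_eq_mul {R : Type*} [CommRing R] {m : ℕ} {b c α : R}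
    (h : (trinomial m b c).IsRoot α) :
    trinomial m b c = trinomialQuotient m b α * (X - C α) := by
  have hc : c = -(α + b) * α ^ m := by
    simp only [trinomial, IsRoot.def, eval_add, eval_mul, eval_pow, eval_X, eval_C] at h
    linear_combination h
  rw [trinomial, trinomialQuotient, add_mul, mul_assoc, geom_sum₂_mul, hc]
  simp only [map_add, map_mul, map_neg, map_pow]
  ring

theorem trinomial_degree_lt {R : Type*} [CommRing R] [Nontrivial R] (m : ℕ)
    (b c : R) : (C b * X ^ m + C c).degree < ((m + 1 : ℕ) : WithBot ℕ) := by
  refine (degree_add_le _ _).trans_lt (max_lt ?_ ?_)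
  · exact (degree_C_mul_X_pow_le m b).trans_lt (by exact_mod_cast Nat.lt_succ_self m)
  · exact degree_C_le.trans_lt (by exact_mod_cast Nat.succ_pos m)

theorem trinomial_monic {R : Type*} [CommRing R] [Nontrivial R] (m : ℕ) (b c : R) :
    (trinomial m b c).Monic := by
  rw [trinomial, add_assoc]
  exact monic_X_pow_add (trinomial_degree_lt m b c)

theorem trinomial_natDegree {R : Type*} [CommRing R] [Nontrivial R] (m : ℕ)
    (b c : R) : (trinomial m b c).natDegree = m + 1 := by
  rw [trinomial, add_assoc]
  exact natDegree_eq_of_degree_eq_some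
    ((degree_add_eq_left_of_degree_lt (by
      rw [degree_X_pow]; exact trinomial_degree_lt m b c)).trans (degree_X_pow _))

theorem trinomial_map {R S : Type*} [CommRing R] [CommRing S] (g : R →+* S) (m : ℕ) (b c : R) :
    (trinomial m b c).map g = trinomial m (g b) (g c) := by
  simp [trinomial]

theorem norm_add_mul_norm_pow {m : ℕ} {b c α : ℂ} (h : (trinomial m b c).IsRoot α) :
    ‖α + b‖ * ‖α‖ ^ m = ‖c‖ := by
  have hc : (α + b) * α ^ m = -c := by
    simp only [trinomial, IsRoot.def, eval_add, eval_mul, eval_pow, eval_X, eval_C] at h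
    linear_combination h
  rw [← norm_pow, ← norm_mul, hc, norm_neg]

/-- A strong form of Perron's criterion: once a root `α` with `1 ≤ |α|` is removed, all remaining
roots lie in the open unit disc. -/
theorem norm_lt_one_of_isRoot_trinomialQuotient {m : ℕ} {b c α β : ℂ}
    (hbc : ‖c‖ + 1 < ‖b‖) (hα : (trinomial m b c).IsRoot α) (hα1 : 1 ≤ ‖α‖)
    (hβ : (trinomialQuotient m b α).IsRoot β) : ‖β‖ < 1 := by
  by_contra hβ1
  push Not at hβ1
  have hc := norm_add_mul_norm_pow hα
  have hβm : β ^ m = -((α + b) * ∑ i ∈ Finset.range m, β ^ i * α ^ (m - 1 - i)) := by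
    simp only [trinomialQuotient, IsRoot.def, eval_add, eval_mul, eval_pow, eval_X, eval_C,
      eval_finsetSum] at hβ
    linear_combination hβ
  have h1 : ‖∑ i ∈ Finset.range m, β ^ i * α ^ (m - 1 - i)‖ ≤
      ‖β‖ ^ m * ∑ i ∈ Finset.range m, ‖α‖ ^ i := by
    rw [← Finset.sum_range_reflect (fun i => ‖α‖ ^ i), Finset.mul_sum]
    refine norm_sum_le_of_le _ fun i hi => ?_
    rw [norm_mul, norm_pow, norm_pow]
    refine mul_le_mul_of_nonneg_right (pow_le_pow_right₀ hβ1 ?_) (by positivity)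
    exact (Finset.mem_range.mp hi).le
  have h2 : ‖β‖ ^ m ≤ ‖α + b‖ * (‖β‖ ^ m * ∑ i ∈ Finset.range m, ‖α‖ ^ i) := by
    calc ‖β‖ ^ m = ‖α + b‖ * ‖∑ i ∈ Finset.range m, β ^ i * α ^ (m - 1 - i)‖ := by
          rw [← norm_pow, hβm, norm_neg, norm_mul]
      _ ≤ _ := mul_le_mul_of_nonneg_left h1 (norm_nonneg _)
  have hpos : 0 < ‖β‖ ^ m := by positivity
  -- Multiplied by `‖α‖ - 1`, this becomes `‖α + b‖ + ‖α‖ ≤ ‖c‖ + 1 < ‖b‖`, using `‖α + b‖ ‖α‖ ^ m =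
  -- ‖c‖`; the triangle inequality is violated.
  have h3 : 1 ≤ ‖α + b‖ * ∑ i ∈ Finset.range m, ‖α‖ ^ i := by
    by_contra hlt
    push Not at hlt
    nlinarith
  have h4 := geom_sum_mul ‖α‖ m
  have h5 : ‖α‖ - 1 ≤ ‖α + b‖ * (‖α‖ ^ m - 1) := by
    rw [← h4]
    nlinarith
  have h6 : ‖b‖ ≤ ‖α + b‖ + ‖α‖ := by
    have := norm_sub_le (α + b) α
    rwa [add_sub_cancel_left] at this
  nlinarith

/-- If `‖α‖ < ‖b‖ - 1`, then `t = ‖α + b‖ > 1`. From `t‖α‖² ≤ ‖c‖` one gets `t ≤ ‖c‖`, so `‖α‖ ≥ 2`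
and `2t‖α‖ ≤ ‖c‖`. But `(t - 1)(‖α‖ - 1) ≥ 0` gives `‖c‖ + 2 ≤ t + ‖α‖ ≤ t‖α‖ + 1`. -/
theorem norm_sub_one_le_of_isRoot {m : ℕ} (hm : 2 ≤ m) {b c α : ℂ}
    (hbc : ‖c‖ + 2 ≤ ‖b‖) (hα : (trinomial m b c).IsRoot α) (hα1 : 1 ≤ ‖α‖) :
    ‖b‖ - 1 ≤ ‖α‖ := by
  have hc := norm_add_mul_norm_pow hα
  have h6 : ‖b‖ ≤ ‖α + b‖ + ‖α‖ := by
    have := norm_sub_le (α + b) α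
    rwa [add_sub_cancel_left] at this
  have h7 : ‖α‖ ^ 2 ≤ ‖α‖ ^ m := pow_le_pow_right₀ hα1 hm
  have h0 := norm_nonneg (α + b)
  by_contra hlt
  push Not at hlt
  have ht : 1 < ‖α + b‖ := by linarith
  have h8 : ‖α + b‖ * ‖α‖ ^ 2 ≤ ‖c‖ := hc ▸ mul_le_mul_of_nonneg_left h7 h0
  have h9 : ‖α + b‖ ≤ ‖c‖ :=
    (le_mul_of_one_le_right h0 (one_le_pow₀ hα1)).trans h8
  have h10 : 2 ≤ ‖α‖ := by linarith
  nlinarith [mul_nonneg (sub_nonneg.mpr ht.le) (sub_nonneg.mpr hα1),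
    mul_nonneg h0 (sub_nonneg.mpr h10), mul_nonneg (mul_nonneg h0 (norm_nonneg α)) (sub_nonneg.mpr h10)]

/-- A monic complex polynomial of positive degree all of whose roots lie in the open unit disc has
constant coefficient of norm less than one. -/
theorem norm_coeff_zero_lt_one {p : ℂ[X]} (hp : p.Monic) (hdeg : p.natDegree ≠ 0)
    (h : ∀ z, p.IsRoot z → ‖z‖ < 1) : ‖p.coeff 0‖ < 1 := by
  have hs : p.Splits := IsAlgClosed.splits p
  rw [hs.coeff_zero_eq_prod_roots_of_monic hp, norm_mul, norm_pow, norm_neg, norm_one, one_pow,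
    one_mul]
  have hcard : p.roots.card ≠ 0 := by rwa [← hs.natDegree_eq_card_roots]
  have hlt : ∀ z ∈ p.roots, ‖z‖ < 1 := fun z hz => h z (isRoot_of_mem_roots hz)
  obtain ⟨z, hz⟩ := Multiset.card_pos_iff_exists_mem.mp (Nat.pos_of_ne_zero hcard)
  obtain ⟨s, hs'⟩ := Multiset.exists_cons_of_mem hz
  rw [hs'] at hlt ⊢
  rw [Multiset.prod_cons, norm_mul]
  have hle : ‖s.prod‖ ≤ 1 := by
    have hs1 : ∀ w ∈ s, ‖w‖ < 1 := fun w hw => hlt w (Multiset.mem_cons_of_mem hw)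
    clear hs' hlt
    induction s using Multiset.induction_on with
    | empty => simp
    | cons w s ih =>
      rw [Multiset.prod_cons, norm_mul]
      exact mul_le_one₀ (hs1 w (Multiset.mem_cons_self w s)).le (norm_nonneg _)
        (ih fun u hu => hs1 u (Multiset.mem_cons_of_mem hu))
  have := hlt z (Multiset.mem_cons_self z s)
  nlinarith [norm_nonneg z, norm_nonneg s.prod]

/-- An integer monic polynomial with nonzero constant coefficient and positive degree has a
complex root outside the open unit disc. -/
theorem exists_root_one_le_norm {p : ℤ[X]} (hp : p.Monic) (hdeg : p.natDegree ≠ 0)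
    (h0 : p.coeff 0 ≠ 0) : ∃ z, (p.map (Int.castRingHom ℂ)).IsRoot z ∧ 1 ≤ ‖z‖ := by
  by_contra hcon
  push Not at hcon
  have := norm_coeff_zero_lt_one (hp.map (Int.castRingHom ℂ))
    (by rwa [hp.natDegree_map]) hcon
  rw [coeff_map, eq_intCast, Complex.norm_intCast] at this
  have h1 : |p.coeff 0| < 1 := by exact_mod_cast this
  exact h0 (Int.abs_lt_one_iff.mp h1)

theorem trinomial_irreducible {m : ℕ} (hm : 1 ≤ m) {b c : ℤ} (hc : c ≠ 0)
    (hbc : |c| + 1 < |b|) : Irreducible (trinomial m b c) := by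
  have hmon := trinomial_monic m b c
  rw [hmon.irreducible_iff_natDegree]
  refine ⟨fun h => ?_, fun p q hp hq hpq => ?_⟩
  · have := congrArg natDegree h
    rw [trinomial_natDegree m, natDegree_one] at this
    omega
  · by_contra hcon
    push Not at hcon
    have h0 : (trinomial m b c).coeff 0 = c := by
      have : m ≠ 0 := by omega
      simp [trinomial, coeff_X_pow, this.symm]
    rw [← hpq, mul_coeff_zero] at h0
    have hp0 : p.coeff 0 ≠ 0 := by
      rintro h; rw [h, zero_mul] at h0; exact hc h0.symm
    have hq0 : q.coeff 0 ≠ 0 := by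
      rintro h; rw [h, mul_zero] at h0; exact hc h0.symm
    obtain ⟨α, hα, hα1⟩ := exists_root_one_le_norm hp hcon.1 hp0
    obtain ⟨β, hβ, hβ1⟩ := exists_root_one_le_norm hq hcon.2 hq0
    have hprod := congrArg (map (Int.castRingHom ℂ)) hpq
    rw [Polynomial.map_mul, trinomial_map] at hprod
    have hαroot : (trinomial m (b : ℂ) (c : ℂ)).IsRoot α := by
      have := IsRoot.def.mp hα
      rw [IsRoot.def, ← eq_intCast (Int.castRingHom ℂ), ← eq_intCast (Int.castRingHom ℂ) c,
        ← hprod, eval_mul, this, zero_mul]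
    obtain ⟨r, hr⟩ := dvd_iff_isRoot.mpr hα
    -- Cancelling `X - C α` shows that `q` divides the quotient, so `β` is a root of it even if `β =
    -- α`.
    have hquot : trinomialQuotient m (b : ℂ) α = r * q.map (Int.castRingHom ℂ) := by
      have h1 := trinomial_eq_mul hαroot
      apply mul_right_cancel₀ (X_sub_C_ne_zero α)
      rw [← h1, ← eq_intCast (Int.castRingHom ℂ), ← eq_intCast (Int.castRingHom ℂ) c, ← hprod, hr]
      ring
    refine hβ1.not_gt (norm_lt_one_of_isRoot_trinomialQuotient (c := c) ?_ hαroot hα1 ?_)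
    · rw [Complex.norm_intCast, Complex.norm_intCast]
      exact_mod_cast hbc
    · rw [hquot, IsRoot.def, eval_mul, IsRoot.def.mp hβ, mul_zero]

end Trinomial

/-! ### Gram matrix of conjugate elements under the Minkowski embedding -/

section NumberField

variable {K : Type*} [Field K] [NumberField K]

theorem norm_sq_minkowskiEmbedding (x : K) :
    ‖minkowskiEmbedding K x‖ ^ 2 = ∑ φ : K →+* ℂ, ‖φ x‖ ^ 2 := by
  have h := inner_minkowskiEmbedding K x x
  rw [real_inner_self_eq_norm_sq] at h
  simp only [Complex.mul_conj'] at h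
  exact_mod_cast h

theorem abs_inner_minkowskiEmbedding_le (x y : K) :
    |inner ℝ (minkowskiEmbedding K x) (minkowskiEmbedding K y)| ≤
      ∑ φ : K →+* ℂ, ‖φ x‖ * ‖φ y‖ := by
  rw [← Real.norm_eq_abs, ← Complex.norm_real, inner_minkowskiEmbedding]
  refine norm_sum_le_of_le _ fun φ _ => ?_
  rw [norm_mul, RCLike.norm_conj]

/-- Sums over all complex embeddings are invariant under automorphisms of the field. -/
theorem sum_embeddings_apply_ringEquiv {M : Type*} [AddCommMonoid M] (σ : K ≃+* K) (F : ℂ → M)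
    (x : K) : ∑ φ : K →+* ℂ, F (φ (σ x)) = ∑ φ : K →+* ℂ, F (φ x) := by
  refine Fintype.sum_equiv ⟨fun φ => φ.comp σ, fun φ => φ.comp σ.symm, fun φ => ?_, fun φ => ?_⟩
    _ _ fun φ => rfl
  · ext y; simp
  · ext y; simp

/-- If under each embedding exactly one of the conjugate elements `α i` is sent to a large number
`z` and the others are sent to the unit disc, then the Minkowski images of the `α i` are nearly
orthogonal. -/
theorem isQuasiOrthogonal_minkowskiEmbedding {n : ℕ} (hn : 2 ≤ n) {α : Fin n → K} {z : ℂ}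
    (hz : 9 * ((n : ℝ) - 1) ≤ ‖z‖)
    (hle : ∀ (φ : K →+* ℂ) i, φ (α i) ≠ z → ‖φ (α i)‖ ≤ 1)
    (huniq : ∀ φ : K →+* ℂ, ∃! i, φ (α i) = z)
    (hconj : ∀ i j, ∃ σ : K ≃+* K, σ (α i) = α j) :
    ∃ D, IsQuasiOrthogonal (fun i => minkowskiEmbedding K (α i)) D := by
  classical
  let i₀ : Fin n := ⟨0, by omega⟩
  set D : ℝ := ∑ φ : K →+* ℂ, ‖φ (α i₀)‖ ^ 2 with hD
  set N : ℝ := ∑ φ : K →+* ℂ, (if φ (α i₀) = z then 1 else 0 : ℝ) with hN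
  have hDi : ∀ i, ∑ φ : K →+* ℂ, ‖φ (α i)‖ ^ 2 = D := fun i => by
    obtain ⟨σ, hσ⟩ := hconj i₀ i
    rw [← hσ]
    exact sum_embeddings_apply_ringEquiv σ (fun w => ‖w‖ ^ 2) (α i₀)
  have hNi : ∀ i, ∑ φ : K →+* ℂ, (if φ (α i) = z then 1 else 0 : ℝ) = N := fun i => by
    obtain ⟨σ, hσ⟩ := hconj i₀ i
    rw [← hσ]
    exact sum_embeddings_apply_ringEquiv σ (fun w => if w = z then (1 : ℝ) else 0) (α i₀)
  -- Double count of the pairs `(i, φ)` with `φ (α i) = z`.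
  have hcard : (n : ℝ) * N = Fintype.card (K →+* ℂ) := by
    have h1 : ∑ i, ∑ φ : K →+* ℂ, (if φ (α i) = z then 1 else 0 : ℝ) = n * N := by
      simp [hNi]
    rw [← h1, Finset.sum_comm]
    have h2 : ∀ φ : K →+* ℂ, ∑ i, (if φ (α i) = z then 1 else 0 : ℝ) = 1 := fun φ => by
      obtain ⟨i, hi, hi'⟩ := huniq φ
      rw [Finset.sum_eq_single i (fun j _ hj => if_neg fun h => hj (hi' j h)) (by simp), if_pos hi]
    simp [h2]
  have hcard0 : (0 : ℝ) < Fintype.card (K →+* ℂ) := by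
    rw [NumberField.Embeddings.card]
    exact_mod_cast Module.finrank_pos
  have hn' : (2 : ℝ) ≤ n := by exact_mod_cast hn
  have hN0 : 0 < N := by
    rw [← hcard] at hcard0
    exact pos_of_mul_pos_right hcard0 (by positivity)
  have hA : 9 ≤ ‖z‖ := by linarith
  have hDN : N * ‖z‖ ^ 2 ≤ D := by
    rw [hN, hD, Finset.sum_mul]
    refine Finset.sum_le_sum fun φ _ => ?_
    split_ifs with h
    · rw [h, one_mul]
    · rw [zero_mul]; positivity
  have hD0 : 0 < D := lt_of_lt_of_le (by positivity) hDN
  refine ⟨D, isQuasiOrthogonal_of_abs_inner_le (ε := 1 / (4 * ((n : ℝ) - 1))) hD0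
    (fun i => by rw [norm_sq_minkowskiEmbedding, hDi]) ?_ fun i j hij => ?_⟩
  · rw [mul_one_div_cancel (by linarith)]
  · refine (abs_inner_minkowskiEmbedding_le _ _).trans ?_
    have hterm : ∀ φ : K →+* ℂ, ‖φ (α i)‖ * ‖φ (α j)‖ ≤
        (if φ (α i) = z then 1 else 0 : ℝ) * ‖z‖ + (if φ (α j) = z then 1 else 0 : ℝ) * ‖z‖ + 1 := by
      intro φ
      by_cases hi : φ (α i) = z
      · have hj : φ (α j) ≠ z := fun hj => hij ((huniq φ).unique hi hj)
        have := hle φ j hj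
        rw [if_pos hi, if_neg hj, hi]
        nlinarith [norm_nonneg z]
      · have h1 := hle φ i hi
        by_cases hj : φ (α j) = z
        · rw [if_neg hi, if_pos hj, hj]
          nlinarith [norm_nonneg z]
        · have h2 := hle φ j hj
          rw [if_neg hi, if_neg hj]
          nlinarith [norm_nonneg (φ (α i)), norm_nonneg (φ (α j))]
    refine (Finset.sum_le_sum fun φ _ => hterm φ).trans ?_
    rw [Finset.sum_add_distrib, Finset.sum_add_distrib, ← Finset.sum_mul, ← Finset.sum_mul, hNi,
      hNi, Finset.sum_const, Finset.card_univ, nsmul_eq_mul, mul_one, ← hcard]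
    rw [one_div_mul_eq_div, le_div_iff₀ (by linarith)]
    refine le_trans ?_ hDN
    -- Here the constant 9 enters: `‖z‖(‖z‖ - 8(n - 1)) ≥ 9(n - 1)² ≥ 4n(n - 1)` for `n ≥ 2`.
    have hmain : (2 * ‖z‖ + n) * (4 * ((n : ℝ) - 1)) ≤ ‖z‖ ^ 2 := by nlinarith
    nlinarith

end NumberField

/-! ### Roots in the splitting field and transitivity of its automorphisms -/

section Roots

variable {f : ℤ[X]}

theorem irreducible_map_rat (hmon : f.Monic) (hirr : Irreducible f) :
    Irreducible (f.map (Int.castRingHom ℚ)) :=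
  (IsPrimitive.Int.irreducible_iff_irreducible_map_cast hmon.isPrimitive).mp hirr

theorem map_algebraMap_rat_splitField :
    (f.map (Int.castRingHom ℚ)).map (algebraMap ℚ (SplitField f)) =
      f.map (algebraMap ℤ (SplitField f)) := by
  rw [Polynomial.map_map]
  congr 1

theorem splits_splitField : (f.map (algebraMap ℤ (SplitField f))).Splits := by
  rw [← map_algebraMap_rat_splitField]
  exact IsSplittingField.splits _ _

theorem card_rootSet_splitField (hmon : f.Monic) (hirr : Irreducible f) :
    Fintype.card (f.rootSet (SplitField f)) = f.natDegree := by
  have h := card_rootSet_eq_natDegree (K := SplitField f) (irreducible_map_rat hmon hirr).separable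
    (IsSplittingField.splits _ _)
  rw [hmon.natDegree_map] at h
  classical
  rw [← h, ← Nat.card_eq_fintype_card, ← Nat.card_eq_fintype_card]
  congr 2
  ext x
  rw [rootSet_def, rootSet_def, aroots_def, aroots_def, map_algebraMap_rat_splitField]

theorem exists_ringEquiv_of_isRoot (hmon : f.Monic) (hirr : Irreducible f) {x y : SplitField f}
    (hx : aeval x f = 0) (hy : aeval y f = 0) : ∃ σ : SplitField f ≃+* SplitField f, σ x = y := by
  have : Normal ℚ (SplitField f) := Normal.of_isSplittingField (f.map (Int.castRingHom ℚ))
  have hmin : ∀ w : SplitField f, aeval w f = 0 →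
      minpoly ℚ w = f.map (Int.castRingHom ℚ) := fun w hw => by
    refine (minpoly.eq_of_irreducible_of_monic (irreducible_map_rat hmon hirr) ?_
      (hmon.map _)).symm
    rw [aeval_def, ← eval_map, map_algebraMap_rat_splitField, eval_map, ← aeval_def, hw]
  obtain ⟨σ, hσ⟩ := (isConjRoot_iff_exists_algEquiv (K := ℚ) (x := y) (y := x)).mp
    ((hmin y hy).trans (hmin x hx).symm)
  exact ⟨σ.toRingEquiv, hσ⟩

end Roots

/-! ### The conjugate lattice of the trinomial -/

theorem isQuasiOrthogonal_conjLattice_trinomial {m : ℕ} (hm : 2 ≤ m) {b c : ℤ} (hc : c ≠ 0)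
    (hbc : |c| + 1 < |b|) (hb : 9 * (m : ℝ) + 1 ≤ |(b : ℝ)|) :
    ∃ (v : Fin (m + 1) → MinkowskiSpace (SplitField (trinomial m b c))) (D : ℝ),
      IsQuasiOrthogonal v D ∧
        conjLattice (trinomial m b c) = Submodule.span ℤ (Set.range v) := by
  set f := trinomial m b c with hf
  have hirr : Irreducible f := trinomial_irreducible (by omega) hc hbc
  have hmon : f.Monic := trinomial_monic m b c
  have hdeg : f.natDegree = m + 1 := trinomial_natDegree m b c
  have hmap : f.map (Int.castRingHom ℂ) = trinomial m (b : ℂ) (c : ℂ) := by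
    rw [hf, trinomial_map, eq_intCast, eq_intCast]
  have hbcC : ‖(c : ℂ)‖ + 2 ≤ ‖(b : ℂ)‖ := by
    rw [Complex.norm_intCast, Complex.norm_intCast]
    have : |c| + 2 ≤ |b| := by omega
    exact_mod_cast this
  obtain ⟨z, hz, hz1⟩ := exists_root_one_le_norm hmon (by omega) (by
    have : m ≠ 0 := by omega
    simpa [hf, trinomial, coeff_X_pow, this.symm] using hc)
  rw [hmap] at hz
  have hzb := norm_sub_one_le_of_isRoot hm hbcC hz hz1
  rw [Complex.norm_intCast] at hzb
  have e : Fin (m + 1) ≃ f.rootSet (SplitField f) :=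
    (Fintype.equivFinOfCardEq ((card_rootSet_splitField hmon hirr).trans hdeg)).symm
  have haeval : ∀ i, aeval (e i : SplitField f) f = 0 := fun i => (mem_rootSet.mp (e i).2).2
  have hroot : ∀ (φ : SplitField f →+* ℂ) i,
      (trinomial m (b : ℂ) (c : ℂ)).IsRoot (φ (e i)) := fun φ i => by
    have h := congrArg φ (haeval i)
    rw [map_zero, aeval_def, hom_eval₂] at h
    rw [← hmap, IsRoot.def, eval_map]
    rwa [Subsingleton.elim (Int.castRingHom ℂ) (φ.comp (algebraMap ℤ (SplitField f)))]
  have hle : ∀ (φ : SplitField f →+* ℂ) i, φ (e i) ≠ z → ‖φ (e i)‖ ≤ 1 := fun φ i hne => by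
    refine (norm_lt_one_of_isRoot_trinomialQuotient (c := (c : ℂ)) (by linarith) hz hz1 ?_).le
    have h := hroot φ i
    rw [trinomial_eq_mul hz, root_mul, root_X_sub_C] at h
    exact h.resolve_right fun h => hne h.symm
  have huniq : ∀ φ : SplitField f →+* ℂ, ∃! i, φ (e i) = z := fun φ => by
    have hzmem : z ∈ f.rootSet ℂ := by
      rw [mem_rootSet]
      refine ⟨hirr.ne_zero, ?_⟩
      rw [aeval_def, ← eval_map]
      rw [← hmap] at hz
      exact hz
    -- As `f` splits in the source, `φ` maps its roots onto all complex roots; uniqueness is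
    -- injectivity of `φ`.
    rw [← splits_splitField.image_rootSet_of_map_ne_zero φ.toIntAlgHom
      (hmon.map _).ne_zero] at hzmem
    obtain ⟨x, hx, hxz⟩ := hzmem
    refine ⟨e.symm ⟨x, hx⟩, by simpa using hxz, fun j hj => ?_⟩
    rw [Equiv.eq_symm_apply]
    exact Subtype.ext (φ.injective (hj.trans hxz.symm))
  obtain ⟨D, hD⟩ := isQuasiOrthogonal_minkowskiEmbedding (α := fun i => (e i : SplitField f))
    (by omega) (z := z) (by push_cast; linarith) hle huniq
    fun i j => exists_ringEquiv_of_isRoot hmon hirr (haeval i) (haeval j)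
  refine ⟨_, D, hD, ?_⟩
  rw [conjLattice, rootModule, Submodule.map_span]
  congr 1
  ext x
  constructor
  · rintro ⟨y, hy, rfl⟩
    exact ⟨e.symm ⟨y, hy⟩, by simp⟩
  · rintro ⟨i, rfl⟩
    exact ⟨e i, (e i).2, rfl⟩

/-- `f` is irreducible of degree `n` and its lattice `L_f` of rank `n` is generic well-rounded,
nearly orthogonal and has a basis of minimal vectors. -/
def HasGoodLattice (n : ℕ) (f : ℤ[X]) : Prop :=
  f.natDegree = n ∧ Irreducible f ∧ IsLatticeOfRank (conjLattice f) n ∧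
    IsGenericWellRounded (conjLattice f) ∧ IsNearlyOrthogonal (conjLattice f) ∧
    HasMinimalBasis (conjLattice f)

theorem hasGoodLattice_trinomial {m : ℕ} (hm : 2 ≤ m) {b c : ℤ} (hc : c ≠ 0)
    (hbc : |c| + 1 < |b|) (hb : 9 * (m : ℝ) + 1 ≤ |(b : ℝ)|) :
    HasGoodLattice (m + 1) (trinomial m b c) := by
  obtain ⟨v, D, hv, hL⟩ := isQuasiOrthogonal_conjLattice_trinomial hm hc hbc hb
  refine ⟨trinomial_natDegree m b c, trinomial_irreducible (by omega) hc hbc, ?_⟩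
  rw [hL]
  exact ⟨hv.isLatticeOfRank, hv.isGenericWellRounded m.succ_pos, hv.isNearlyOrthogonal,
    hv.hasMinimalBasis m.succ_pos⟩

/-- The explicit bound matters only through `|a₀| > 9(n - 1)`, which makes the large root large
enough. For `n ≥ 4` the denominator is at most 8 and `n! ≥ 24`; for `n = 3` this estimate is too
weak, and `√33` is bounded directly. -/
theorem nine_mul_le_bound {n : ℕ} (hn : 3 ≤ n) :
    9 * ((n : ℝ) - 1) ≤ 8 * ((n : ℝ) - 1) * (n.factorial : ℝ) /
      (Real.sqrt (((n : ℝ) - 2) ^ 2 + 16 * ((n : ℝ) - 1)) - ((n : ℝ) - 2)) := by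
  have hn' : (3 : ℝ) ≤ n := by exact_mod_cast hn
  set s := Real.sqrt (((n : ℝ) - 2) ^ 2 + 16 * ((n : ℝ) - 1)) with hs
  have hs2 : s ^ 2 = ((n : ℝ) - 2) ^ 2 + 16 * ((n : ℝ) - 1) := Real.sq_sqrt (by nlinarith)
  have hs0 : 0 ≤ s := Real.sqrt_nonneg _
  have hlow : (n : ℝ) - 2 < s := by nlinarith
  have hup : 9 * (s - ((n : ℝ) - 2)) ≤ 8 * n.factorial := by
    rcases hn.eq_or_lt with rfl | hn4
    · norm_num [Nat.factorial] at hs2 ⊢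
      nlinarith
    · have hfac : (24 : ℝ) ≤ n.factorial := by
        exact_mod_cast (Nat.factorial_le hn4 : Nat.factorial 4 ≤ n.factorial)
      have hs8 : s ≤ n + 6 := Real.sqrt_le_iff.mpr ⟨by linarith, by nlinarith⟩
      linarith
  rw [le_div_iff₀ (by linarith)]
  nlinarith [mul_le_mul_of_nonneg_left hup (by linarith : (0 : ℝ) ≤ n - 1)]

theorem hasGoodLattice_of_bound {n : ℕ} (hn : 3 ≤ n) {a₀ a : ℤ}
    (h₀ : 8 * ((n : ℝ) - 1) * (n.factorial : ℝ) /
        (Real.sqrt (((n : ℝ) - 2) ^ 2 + 16 * ((n : ℝ) - 1)) - ((n : ℝ) - 2)) < |(a₀ : ℝ)|)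
    (h : |a₀| + 1 < |a|) : HasGoodLattice n (X ^ n + C a * X ^ (n - 1) + C a₀) := by
  obtain ⟨m, rfl⟩ : ∃ m, n = m + 1 := ⟨n - 1, by omega⟩
  have hb := (nine_mul_le_bound hn).trans_lt h₀
  push_cast at hb
  have hm : (2 : ℝ) ≤ m := by exact_mod_cast (by omega : 2 ≤ m)
  have h' : |(a₀ : ℝ)| + 1 < |(a : ℝ)| := by exact_mod_cast h
  refine hasGoodLattice_trinomial (by omega) ?_ h (by linarith)
  rintro rfl
  norm_num at hb
  linarith

end ConjugateLattice

theorem theorem1p4 (n : ℕ) (hn : 3 ≤ n) (hp : n.Prime) :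
    Set.Infinite {f : ℤ[X] | f.natDegree = n ∧ Irreducible f ∧
      ConjugateLattice.IsLatticeOfRank (ConjugateLattice.conjLattice f) n ∧
      ConjugateLattice.IsGenericWellRounded (ConjugateLattice.conjLattice f) ∧
      ConjugateLattice.IsNearlyOrthogonal (ConjugateLattice.conjLattice f) ∧
      ConjugateLattice.HasMinimalBasis (ConjugateLattice.conjLattice f)} ∧
    ∀ (a₀ a : ℤ) (f : ℤ[X]),
      8 * ((n : ℝ) - 1) * (n.factorial : ℝ) /
          (Real.sqrt (((n : ℝ) - 2) ^ 2 + 16 * ((n : ℝ) - 1)) - ((n : ℝ) - 2)) < |(a₀ : ℝ)| →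
      |a₀| + 1 < |a| →
      f = X ^ n + C a * X ^ (n - 1) + C a₀ →
      f.natDegree = n ∧ Irreducible f ∧
        ConjugateLattice.IsLatticeOfRank (ConjugateLattice.conjLattice f) n ∧
        ConjugateLattice.IsGenericWellRounded (ConjugateLattice.conjLattice f) ∧
        ConjugateLattice.IsNearlyOrthogonal (ConjugateLattice.conjLattice f) ∧
        ConjugateLattice.HasMinimalBasis (ConjugateLattice.conjLattice f) := by
  refine ⟨?_, ?_⟩
  · set B := 8 * ((n : ℝ) - 1) * (n.factorial : ℝ) /
      (Real.sqrt (((n : ℝ) - 2) ^ 2 + 16 * ((n : ℝ) - 1)) - ((n : ℝ) - 2)) with hB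
    obtain ⟨N, hN⟩ := exists_nat_gt B
    refine Set.infinite_of_injective_forall_mem
      (f := fun k : ℕ => (X ^ n + C ((N : ℤ) + 2 + k) * X ^ (n - 1) + C (N : ℤ) : ℤ[X])) ?_ ?_
    -- Members of the family differ only in the coefficient of `X ^ (n - 1)`, so the value at 1
    -- separates them.
    · intro k l hkl
      have h1 := congrArg (eval 1) hkl
      simpa using h1
    · intro k
      refine ConjugateLattice.hasGoodLattice_of_bound hn ?_ ?_
      · simpa using hN
      · rw [abs_of_nonneg (by positivity), abs_of_nonneg (by positivity)]
        omega
  · rintro a₀ a f h₀ h rfl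
    exact ConjugateLattice.hasGoodLattice_of_bound hn h₀ h
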